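/- Theorem (label matching). Consider a structural causal model with endogenous variables $x_1,\dots,x_n$ and exogenous variables $e_1,\dots,e_n$, taking values in arbitrary measurable spaces, with structural equations $x_i=f_i\big((x_j)_{j\ne i},e_1,\dots,e_n\big)$ (almost surely), where the $f_i$ are measurable and $e_1,\dots,e_n$ are mutually independent. A variable $z$ (endogenous or exogenous) is called a parent of $x_i$ if $f_i$ cannot be written as a function of the remaining variables without $z$; exogenous variables have no parents. Let $\mathcal G$ be the resulting directed graph on $x_1,\dots,x_n$, and $\mathcal G^a$ the resulting directed graph on $x_1,\dots,x_n,e_1,\dots,e_n$. Assume that 1. $\mathcal G$ is acyclic; 2. for every $i$, $e_i$ is the only exogenous parent of $x_i$; 3. (faithfulness, without conditioning) whenever $x_i$ and $e_j$ are independent, they are d-separated by the empty set in $\mathcal G^a$, i.e. every trail in $\mathcal G^a$ between $x_i$ and $e_j$ contains a collider $u\to v\leftarrow w$. Let $I(X;Y)\in[0,\infty]$ denote mutual information, i.e. the Kullback–Leibler divergence of the joint law of $(X,Y)$ from the product of the marginal laws. Then for every permutation $(i_1,\dots,i_n)$ of $(1,\dots,n)$, the following are equivalent: (a) $(e_{i_1},\dots,e_{i_n})$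 is the true matching, i.e. $i_m=m$ for all $m=1,\dots,n$; (b) $I(x_m;e_{i_m})\neq 0$ for all $m$, and $(i_1,\dots,i_n)$ maximizes $\sum_{m=1}^n I(x_m;e_{j_m})$ among all permutations $(j_1,\dots,j_n)$ with $I(x_m;e_{j_m})\ne 0$ for all $m$. -/

import Mathlib

open MeasureTheory ProbabilityTheory

/-! ### Directed graphs, trails and d-separation -/

/-- A directed graph is acyclic if no vertex is reached from itself by a path of positive length. -/
def Digraph.Acyclic {V : Type*} (G : Digraph V) : Prop :=
  ∀ v, ¬ Relation.TransGen G.Adj v v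

/-- The `i`-th node of the sequence `p 0, …, p k` is a collider: `p (i-1) → p i ← p (i+1)`. -/
def Digraph.IsColliderAt {V : Type*} (G : Digraph V) (k : ℕ) (p : ℕ → V) (i : ℕ) : Prop :=
  0 < i ∧ i < k ∧ G.Adj (p (i - 1)) (p i) ∧ G.Adj (p (i + 1)) (p i)

/-- `p 0, …, p k` is a trail: distinct nodes, consecutive ones joined by an edge in either
direction. -/
def Digraph.IsTrail {V : Type*} (G : Digraph V) (k : ℕ) (p : ℕ → V) : Prop :=
  Set.InjOn p (Set.Iic k) ∧ ∀ i < k, G.Adj (p i) (p (i + 1)) ∨ G.Adj (p (i + 1)) (p i)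

/-- The trail `p 0, …, p k` is active given `Z`: every collider on it lies in `Z` or has a
descendant in `Z`, and no other node of it lies in `Z`. For `Z = ∅` this says that the trail
contains no collider. -/
def Digraph.IsActiveTrail {V : Type*} (G : Digraph V) (Z : Set V) (k : ℕ) (p : ℕ → V) : Prop :=
  G.IsTrail k p ∧
  (∀ i, G.IsColliderAt k p i → ∃ z ∈ Z, Relation.ReflTransGen G.Adj (p i) z) ∧
  (∀ i ≤ k, ¬ G.IsColliderAt k p i → p i ∉ Z)

/-- `A` and `B` are d-separated given `Z`: no trail from a node of `A` to a node of `B` is active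
given `Z`. -/
def Digraph.DSeparated {V : Type*} (G : Digraph V) (A B Z : Set V) : Prop :=
  ∀ a ∈ A, ∀ b ∈ B, ∀ (k : ℕ) (p : ℕ → V), p 0 = a → p k = b → ¬ G.IsActiveTrail Z k p

/-! ### Structural causal models -/

/-- A structural causal model with endogenous variables `x_1, …, x_n` (with values in `DX i`) and
exogenous variables `e_1, …, e_n` (with values in `DE i`): measurable functions `f i` of all the
other endogenous and all the exogenous variables, and the laws `P i` of the exogenous variables. -/
structure SCM (n : ℕ) (DX DE : Fin n → Type*)
    [∀ i, MeasurableSpace (DX i)] [∀ i, MeasurableSpace (DE i)] where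
  f : ∀ i : Fin n, (∀ j : {j : Fin n // j ≠ i}, DX j) → (∀ j : Fin n, DE j) → DX i
  measurable_f : ∀ i : Fin n, Measurable
    (fun z : (∀ j : {j : Fin n // j ≠ i}, DX j) × (∀ j : Fin n, DE j) => f i z.1 z.2)
  P : ∀ i : Fin n, Measure (DE i)
  isProb : ∀ i : Fin n, IsProbabilityMeasure (P i)

namespace SCM

variable {n : ℕ} {DX DE : Fin n → Type*}
  [∀ i, MeasurableSpace (DX i)] [∀ i, MeasurableSpace (DE i)]

/-- The variable `z` (`Sum.inl j` is `x_j`, `Sum.inr j` is `e_j`) is a parent of `x_i` if `f i`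
cannot be written as a function of the remaining variables without `z`. -/
def IsParent (M : SCM n DX DE) : Fin n ⊕ Fin n → Fin n → Prop
  | Sum.inl j, i =>
      ¬ ∃ g : (∀ k : {k : Fin n // k ≠ i ∧ k ≠ j}, DX k) → (∀ k : Fin n, DE k) → DX i,
        ∀ a b, M.f i a b = g (fun k => a ⟨k.1, k.2.1⟩) b
  | Sum.inr j, i =>
      ¬ ∃ g : (∀ k : {k : Fin n // k ≠ i}, DX k) → (∀ k : {k : Fin n // k ≠ j}, DE k) → DX i,
        ∀ a b, M.f i a b = g a (fun k => b k.1)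

/-- The graph on the endogenous variables. -/
def graph (M : SCM n DX DE) : Digraph (Fin n) where
  Adj j i := M.IsParent (Sum.inl j) i

/-- The graph on all the variables; exogenous variables have no parents. -/
def augmentedGraph (M : SCM n DX DE) : Digraph (Fin n ⊕ Fin n) where
  Adj z w := ∃ i, w = Sum.inl i ∧ M.IsParent z i

/-- `e_i` is the one and only exogenous parent of `x_i`. -/
def OwnExogenous (M : SCM n DX DE) : Prop :=
  ∀ i j : Fin n, M.IsParent (Sum.inr j) i ↔ j = i

/-- The random variables `x`, `e` realize the model: the `e i` are independent with the laws
`P i`, and almost surely `x` solves the structural equations. -/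
structure Realizes (M : SCM n DX DE) {Ω : Type*} [MeasurableSpace Ω] (μ : Measure Ω)
    (x : ∀ i : Fin n, Ω → DX i) (e : ∀ i : Fin n, Ω → DE i) : Prop where
  measurable_x : ∀ i, Measurable (x i)
  measurable_e : ∀ i, Measurable (e i)
  indep : iIndepFun e μ
  law : ∀ i, μ.map (e i) = M.P i
  eqn : ∀ i, ∀ᵐ ω ∂μ, x i ω = M.f i (fun j => x j.1 ω) (fun j => e j ω)

/-- Faithfulness to the augmented graph, without conditioning: whenever an endogenous and an
exogenous variable are independent, they are d-separated given the empty set. -/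
def Faithful (M : SCM n DX DE) {Ω : Type*} [MeasurableSpace Ω] (μ : Measure Ω)
    (x : ∀ i : Fin n, Ω → DX i) (e : ∀ i : Fin n, Ω → DE i) : Prop :=
  ∀ i j : Fin n, IndepFun (x i) (e j) μ →
    M.augmentedGraph.DSeparated {Sum.inl i} {Sum.inr j} ∅

end SCM

/-! ### Mutual information and the matching problem -/

/-- The mutual information `I(X ; Y) ∈ [0, ∞]`: the Kullback-Leibler divergence of the joint law
from the product of the marginal laws. -/
noncomputable def mutualInfo {Ω α β : Type*} [MeasurableSpace Ω] [MeasurableSpace α]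
    [MeasurableSpace β] (μ : Measure Ω) (X : Ω → α) (Y : Ω → β) : ENNReal :=
  InformationTheory.klDiv (μ.map (fun ω => (X ω, Y ω))) ((μ.map X).prod (μ.map Y))

/-- The arrangements `σ` (assigning `e_{σ m}` to `x_m`) with `I(x_m ; e_{σ m}) ≠ 0` for all `m`. -/
def feasibleArrangements {n : ℕ} {DX DE : Fin n → Type*}
    [∀ i, MeasurableSpace (DX i)] [∀ i, MeasurableSpace (DE i)]
    {Ω : Type*} [MeasurableSpace Ω] (μ : Measure Ω)
    (x : ∀ i : Fin n, Ω → DX i) (e : ∀ i : Fin n, Ω → DE i) : Set (Equiv.Perm (Fin n)) :=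
  {σ | ∀ m, mutualInfo μ (x m) (e (σ m)) ≠ 0}

/-- The objective `∑ m, I(x_m ; e_{σ m})`. -/
noncomputable def matchingObjective {n : ℕ} {DX DE : Fin n → Type*}
    [∀ i, MeasurableSpace (DX i)] [∀ i, MeasurableSpace (DE i)]
    {Ω : Type*} [MeasurableSpace Ω] (μ : Measure Ω)
    (x : ∀ i : Fin n, Ω → DX i) (e : ∀ i : Fin n, Ω → DE i) (σ : Equiv.Perm (Fin n)) : ENNReal :=
  ∑ m, mutualInfo μ (x m) (e (σ m))

/-! The maximization in (b) is vacuous: the identity is the only arrangement with all informations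
nonzero (`SCM.feasibleArrangements_eq_singleton`). Nonzero mutual information means dependence. If
`j` is neither `i` nor an ancestor of `i`, unrolling the structural equations along the acyclic
graph expresses `x i` almost surely through the `e k` with `k ≠ j`, so `x i` and `e j` are
independent. A feasible permutation therefore sends each vertex to itself or to an ancestor, and
acyclicity forces it to be the identity. Conversely, faithfulness applied to the single edge from `e
m` to `x m` makes the identity feasible. -/

/-- A function of finitely many variables takes equal values at points that agree on all the
variables whose change may affect it. -/
theorem apply_eq_of_forall_update_eq {ι β : Type*} [Finite ι] [DecidableEq ι] {α : ι → Type*}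
    (F : (∀ k, α k) → β) (P : ι → Prop)
    (h : ∀ k, ¬ P k → ∀ a v, F (Function.update a k v) = F a)
    {a a' : ∀ k, α k} (haa' : ∀ k, P k → a k = a' k) : F a = F a' := by
  cases nonempty_fintype ι
  -- Pass from `a` to `a'` one coordinate at a time; `s` holds the coordinates already switched.
  have key : ∀ s : Finset ι, F (s.piecewise a' a) = F a := by
    intro s
    induction s using Finset.induction_on with
    | empty => simp
    | insert j s _ ih =>
      rw [Finset.piecewise_insert]
      by_cases hj : P j
      · rw [← ih]
        congr 1
        rw [Function.update_eq_self_iff]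
        by_cases hs : j ∈ s
        · simp [hs]
        · simp [hs, haa' j hj]
      · rw [h j hj, ih]
  simpa using (key Finset.univ).symm

/-- If a permutation moves every vertex of an acyclic digraph to one of its ancestors or leaves it
in place, then it is the identity. -/
theorem Digraph.Acyclic.perm_apply_eq {V : Type*} [Finite V] {G : Digraph V} (hG : G.Acyclic)
    (σ : Equiv.Perm V) (h : ∀ v, Relation.ReflTransGen G.Adj (σ v) v) (v : V) : σ v = v := by
  by_contra hne
  have hiter : ∀ (k : ℕ) (w : V), Relation.ReflTransGen G.Adj ((σ ^ k) w) w := by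
    intro k
    induction k with
    | zero => intro w; exact .refl
    | succ k ih =>
      intro w
      rw [pow_succ, Equiv.Perm.mul_apply]
      exact (ih (σ w)).trans (h w)
  -- Following the orbit of `σ v` for `orderOf σ - 1` more steps returns to `v`, which closes a
  -- directed cycle.
  have hback : Relation.ReflTransGen G.Adj v (σ v) := by
    have hpos : 0 < orderOf σ := orderOf_pos σ
    have hv := hiter (orderOf σ - 1) (σ v)
    rwa [← Equiv.Perm.mul_apply, ← pow_succ, Nat.sub_add_cancel hpos, pow_orderOf_eq_one,
      Equiv.Perm.one_apply] at hv
  rcases Relation.reflTransGen_iff_eq_or_transGen.1 (h v) with heq | htrans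
  · exact hne heq.symm
  · exact hG v (htrans.trans_right hback)

theorem Digraph.Acyclic.wellFounded {V : Type*} [Finite V] {G : Digraph V} (hG : G.Acyclic) :
    WellFounded G.Adj := by
  have : Std.Irrefl (Relation.TransGen G.Adj) := ⟨hG⟩
  exact Subrelation.wf (r := Relation.TransGen G.Adj) (fun h => .single h)
    (Finite.wellFounded_of_trans_of_irrefl _)

theorem mutualInfo_eq_zero_iff {Ω α β : Type*} [MeasurableSpace Ω] [MeasurableSpace α]
    [MeasurableSpace β] {μ : Measure Ω} {X : Ω → α} {Y : Ω → β}
    [IsProbabilityMeasure μ] (hX : Measurable X) (hY : Measurable Y) :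
    mutualInfo μ X Y = 0 ↔ IndepFun X Y μ := by
  rw [mutualInfo, InformationTheory.klDiv_eq_zero_iff,
    indepFun_iff_map_prod_eq_prod_map_map hX.aemeasurable hY.aemeasurable]

namespace SCM

variable {n : ℕ} {DX DE : Fin n → Type*}
  [∀ i, MeasurableSpace (DX i)] [∀ i, MeasurableSpace (DE i)]
  {M : SCM n DX DE} {Ω : Type*} [MeasurableSpace Ω] {μ : Measure Ω}
  {x : ∀ i : Fin n, Ω → DX i} {e : ∀ i : Fin n, Ω → DE i}

/-- A structural function depends on the endogenous variables only through the parents. -/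
theorem f_congr_of_parents (M : SCM n DX DE) (i : Fin n)
    {a a' : ∀ j : {j : Fin n // j ≠ i}, DX j} (b : ∀ j, DE j)
    (h : ∀ k : {j : Fin n // j ≠ i}, M.IsParent (Sum.inl k.1) i → a k = a' k) :
    M.f i a b = M.f i a' b := by
  refine apply_eq_of_forall_update_eq (fun a => M.f i a b)
    (fun k => M.IsParent (Sum.inl k.1) i) (fun k hk a v => ?_) h
  obtain ⟨g, hg⟩ := not_not.1 hk
  simp only [hg]
  congr 1
  funext l
  rw [Function.update_of_ne]
  exact fun hl => l.2.2 (congrArg Subtype.val hl)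

/-- A structural function does not depend on an exogenous variable that is not a parent. -/
theorem f_update_exogenous (M : SCM n DX DE) {i j : Fin n} (h : ¬ M.IsParent (Sum.inr j) i)
    (a : ∀ j : {j : Fin n // j ≠ i}, DX j) (b : ∀ j, DE j) (c : DE j) :
    M.f i a (Function.update b j c) = M.f i a b := by
  obtain ⟨g, hg⟩ := not_not.1 h
  simp only [hg]
  congr 1
  funext l
  rw [Function.update_of_ne l.2]

/-- An endogenous variable is almost surely a measurable function of the exogenous variables that
does not involve `e_j` when `x_j` is not among its ancestors. -/
theorem Realizes.exists_eq_of_not_ancestor (hreal : M.Realizes μ x e) [NeZero μ]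
    (hacyclic : M.graph.Acyclic) (hown : M.OwnExogenous) (j : Fin n) (c : DE j) (i : Fin n)
    (hij : ¬ Relation.ReflTransGen M.graph.Adj j i) :
    ∃ H : (∀ k, DE k) → DX i, Measurable H ∧
      ∀ᵐ ω ∂μ, x i ω = H (Function.update (fun k => e k ω) j c) := by
  classical
  induction i using hacyclic.wellFounded.induction with
  | _ i ih =>
    obtain ⟨ω₀⟩ : Nonempty Ω := μ.nonempty_of_neZero
    have hpar : ∀ k, M.graph.Adj k i → ¬ Relation.ReflTransGen M.graph.Adj j k :=
      fun k hk hjk => hij (hjk.tail hk)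
    have hne : j ≠ i := fun h => hij (h ▸ .refl)
    choose H hHm hH using fun k (hk : M.graph.Adj k i) => ih k hk (hpar k hk)
    -- Non-parents get the constant `x k ω₀`: `f i` ignores these entries, and `DX k` is inhabited
    -- only through a sample point.
    let A : (∀ k, DE k) → ∀ k : {k : Fin n // k ≠ i}, DX k := fun b k =>
      if h : M.graph.Adj k.1 i then H k.1 h b else x k.1 ω₀
    have hA : Measurable A := by
      refine measurable_pi_lambda _ fun k => ?_
      by_cases hk : M.graph.Adj k.1 i
      · simpa only [A, dif_pos hk] using hHm k.1 hk
      · simp only [A, dif_neg hk, measurable_const]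
    refine ⟨fun b => M.f i (A b) b, (M.measurable_f i).comp (hA.prodMk measurable_id), ?_⟩
    have hall : ∀ᵐ ω ∂μ, ∀ k, ∀ h : M.graph.Adj k i,
        x k ω = H k h (Function.update (fun k => e k ω) j c) := by
      rw [ae_all_iff]
      intro k
      by_cases hk : M.graph.Adj k i
      · filter_upwards [hH k hk] with ω hω _ using hω
      · exact .of_forall fun _ h => absurd h hk
    filter_upwards [hreal.eqn i, hall] with ω hω hωH
    rw [hω, M.f_update_exogenous (fun h => hne ((hown i j).1 h))]
    refine M.f_congr_of_parents i _ fun k hk => ?_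
    have hk' : M.graph.Adj k.1 i := hk
    simp only [A, dif_pos hk', hωH k.1 hk']

/-- With the coordinate `j` frozen, `x i` is almost surely a function of the family `e k`, `k ≠ j`,
which is independent of `e j`. -/
theorem Realizes.indepFun_of_not_ancestor (hreal : M.Realizes μ x e) [NeZero μ]
    (hacyclic : M.graph.Acyclic) (hown : M.OwnExogenous) {i j : Fin n}
    (hij : ¬ Relation.ReflTransGen M.graph.Adj j i) : IndepFun (x i) (e j) μ := by
  classical
  obtain ⟨ω₀⟩ : Nonempty Ω := μ.nonempty_of_neZero
  obtain ⟨H, hHm, hH⟩ := hreal.exists_eq_of_not_ancestor hacyclic hown j (e j ω₀) i hij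
  have hdisj : Disjoint (Finset.univ.erase j) {j} := by simp
  have hind := hreal.indep.indepFun_finset (Finset.univ.erase j) {j} hdisj hreal.measurable_e
  -- `R` restores the missing coordinate `j` with the same constant `e j ω₀` at which `H` was
  -- frozen.
  let R : (∀ k : (Finset.univ.erase j : Finset (Fin n)), DE k) → ∀ k, DE k := fun b k =>
    if h : k = j then e k ω₀ else b ⟨k, by simp [h]⟩
  have hR : Measurable R := by
    refine measurable_pi_lambda _ fun k => ?_
    by_cases h : k = j
    · simp only [R, dif_pos h, measurable_const]
    · simp only [R, dif_neg h]
      exact measurable_pi_apply _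
  have hev : Measurable fun b : (∀ k : ({j} : Finset (Fin n)), DE k) =>
      b ⟨j, Finset.mem_singleton_self j⟩ := measurable_pi_apply _
  refine (hind.comp (hHm.comp hR) hev).congr ?_ .rfl
  filter_upwards [hH] with ω hω
  rw [hω]
  simp only [Function.comp_apply]
  congr 1
  funext k
  by_cases h : k = j
  · subst h
    simp [R]
  · simp [R, h]

/-- Under faithfulness an endogenous variable depends on its exogenous parents. -/
theorem Faithful.not_indepFun_of_isParent (hfaithful : M.Faithful μ x e) {i j : Fin n}
    (h : M.IsParent (Sum.inr j) i) : ¬ IndepFun (x i) (e j) μ := by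
  intro hind
  have hadj : M.augmentedGraph.Adj (Sum.inr j) (Sum.inl i) := ⟨i, rfl, h⟩
  -- A trail of one edge has no interior node, hence no collider, so it is active given `∅`.
  refine hfaithful i j hind _ rfl _ rfl 1 (fun m => if m = 0 then Sum.inl i else Sum.inr j)
    rfl rfl ⟨⟨?_, ?_⟩, ?_, fun _ _ _ => Set.notMem_empty _⟩
  · intro a ha b hb hab
    rw [Set.mem_Iic] at ha hb
    interval_cases a <;> interval_cases b <;> simp_all
  · intro m hm
    obtain rfl : m = 0 := by omega
    exact Or.inr hadj
  · rintro m ⟨h₀, h₁, _⟩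
    omega

theorem feasibleArrangements_eq_singleton [IsProbabilityMeasure μ] (hacyclic : M.graph.Acyclic)
    (hown : M.OwnExogenous) (hreal : M.Realizes μ x e) (hfaithful : M.Faithful μ x e) :
    feasibleArrangements μ x e = {1} := by
  ext σ
  simp only [feasibleArrangements, Set.mem_ofPred_eq, Set.mem_singleton_iff, ne_eq,
    mutualInfo_eq_zero_iff (hreal.measurable_x _) (hreal.measurable_e _)]
  constructor
  · intro h
    refine Equiv.ext fun v => hacyclic.perm_apply_eq σ (fun m => ?_) v
    by_contra hm
    exact h m (hreal.indepFun_of_not_ancestor hacyclic hown hm)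
  · rintro rfl m
    exact hfaithful.not_indepFun_of_isParent ((hown m m).2 rfl)

end SCM

theorem mainTheorem2 {n : ℕ} {DX DE : Fin n → Type*}
    [∀ i, MeasurableSpace (DX i)] [∀ i, MeasurableSpace (DE i)]
    (M : SCM n DX DE) (hacyclic : M.graph.Acyclic) (hown : M.OwnExogenous)
    {Ω : Type*} [MeasurableSpace Ω] (μ : Measure Ω) [IsProbabilityMeasure μ]
    (x : ∀ i : Fin n, Ω → DX i) (e : ∀ i : Fin n, Ω → DE i)
    (hreal : M.Realizes μ x e) (hfaithful : M.Faithful μ x e)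
    (σ : Equiv.Perm (Fin n)) :
    (∀ m, σ m = m) ↔
      σ ∈ feasibleArrangements μ x e ∧
        IsMaxOn (matchingObjective μ x e) (feasibleArrangements μ x e) σ := by
  rw [SCM.feasibleArrangements_eq_singleton hacyclic hown hreal hfaithful]
  constructor
  · intro h
    obtain rfl : σ = 1 := Equiv.ext h
    refine ⟨rfl, fun τ hτ => ?_⟩
    obtain rfl : τ = 1 := hτ
    exact le_refl (matchingObjective μ x e 1)
  · rintro ⟨rfl, _⟩ m
    rfl
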